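/- Let $d\ge 1$, let $\Omega\subset\mathbb{R}^d$ be a bounded open set, and let $\mathcal T_h$ be a mesh of $\Omega$, i.e. a finite set of pairwise disjoint open $d$-simplices $T\subset\Omega$ with $\overline\Omega=\bigcup_{T\in\mathcal T_h}\overline T$. Let $\nu>0$ and $y_d,u_d\in L^2(\Omega)$. Let $(\cdot,\cdot)$ denote the $L^2(\Omega)$ scalar product, put $a(y,v):=(\nabla y,\nabla v)$ for $y,v\in H^1_0(\Omega)$, and let $$V_h:=\{v_h\in H^1_0(\Omega): v_h|_T\in\mathbb P_1(T)\ \text{for all } T\in\mathcal T_h\},$$ where $\mathbb P_1$ is the space of polynomials of degree at most $1$. Consider the variationally discretized problem $$(\mathrm{P}_h)\qquad\begin{aligned}&\min_{(y_h,u)\in V_h\times L^2(\Omega)} J(y_h,u):=\tfrac12\|y_h-y_d\|_{L^2(\Omega)}^2+\tfrac\nu2\|u-u_d\|_{L^2(\Omega)}^2\\ &\text{s.t. } a(y_h,v_h-y_h)+\|v_h\|_{L^1(\Omega)}-\|y_h\|_{L^1(\Omega)}\ge (u,v_h-y_h)\quad\text{for all } v_h\in V_h.\end{aligned}$$ Then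 the form $a$ is coercive: there is $c>0$ with $$a(v,v)\ge c\,\|v\|_{H^1(\Omega)}^2\quad\text{for all } v\in H^1_0(\Omega).\tag{1}$$ Moreover, let $\bar u_h$, with associated state $\bar y_h$, be a locally optimal solution of $(\mathrm{P}_h)$, i.e. $(\bar y_h,\bar u_h)$ is feasible and $J(\bar y_h,\bar u_h)\le J(y_h,u)$ for all feasible $(y_h,u)$ in some neighbourhood of $(\bar y_h,\bar u_h)$ in $H^1_0(\Omega)\times L^2(\Omega)$. Then $$\bar u_h-u_d\in V_h,$$ and for every $c>0$ that satisfies (1), $$\|\bar u_h-u_d\|_{H^1(\Omega)}\le\frac1{\nu c}\bigl(\|\bar y_h\|_{L^2(\Omega)}+\|y_d\|_{L^2(\Omega)}\bigr),$$ where $\|v\|_{H^1(\Omega)}^2=\|v\|_{L^2(\Omega)}^2+\|\nabla v\|_{L^2(\Omega)}^2$. -/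

import Mathlib

open MeasureTheory Set
open scoped ContDiff

noncomputable section

namespace DiscreteVI

/-- `ℝᵈ` with the Euclidean norm. -/
abbrev Rd (d : ℕ) : Type := EuclideanSpace ℝ (Fin d)

variable {d : ℕ}

/-- The real Hilbert space `L²(Ω)`. -/
abbrev L2 (Ω : Set (Rd d)) : Type := Lp ℝ 2 (volume.restrict Ω)

/-- The Hilbert space `L²(Ω)ᵈ` of square integrable vector fields. -/
abbrev L2Vec (Ω : Set (Rd d)) : Type := Lp (Rd d) 2 (volume.restrict Ω)

/-- The ambient Hilbert space `L²(Ω) × L²(Ω)ᵈ` of pairs `(v, G)`, normed by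
`‖(v, G)‖² = ‖v‖² + ‖G‖²`. A Sobolev function `v` is represented by the pair `(v, ∇v)`, so that
the norm of this space is the full `H¹(Ω)` norm. -/
abbrev Pair (Ω : Set (Rd d)) : Type := WithLp 2 (L2 Ω × L2Vec Ω)

/-- Smooth functions with compact support contained in `Ω`. -/
structure IsTestFunction (Ω : Set (Rd d)) (φ : Rd d → ℝ) : Prop where
  smooth : ContDiff ℝ ∞ φ
  hasCompactSupport : HasCompactSupport φ
  tsupport_subset : tsupport φ ⊆ Ω

/-- The pairs `(φ, ∇φ)`, with `φ` a smooth function with compact support in `Ω`. -/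
def testPairs (Ω : Set (Rd d)) : Set (Pair Ω) :=
  {w | ∃ φ : Rd d → ℝ, IsTestFunction Ω φ ∧
    w.fst =ᵐ[volume.restrict Ω] φ ∧ w.snd =ᵐ[volume.restrict Ω] gradient φ}

/-- `H¹₀(Ω)`: the closure of `C_c^∞(Ω)` with respect to the `H¹` norm. An element `w` consists of a
function `w.fst ∈ L²(Ω)` and of its weak gradient `w.snd = ∇ w.fst`, see
`isWeakGradient_of_mem_H10` and `IsWeakGradient.unique`. -/
def H10 (Ω : Set (Rd d)) : Submodule ℝ (Pair Ω) :=
  (Submodule.span ℝ (testPairs Ω)).topologicalClosure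

/-- `G` is the weak (distributional) gradient of `v` in `Ω`. -/
def IsWeakGradient (Ω : Set (Rd d)) (v : L2 Ω) (G : L2Vec Ω) : Prop :=
  ∀ ψ : Rd d → ℝ, IsTestFunction Ω ψ → ∀ e : Rd d,
    ∫ x in Ω, v x * fderiv ℝ ψ x e = - ∫ x in Ω, inner ℝ (G x) e * ψ x

theorem isWeakGradient_of_mem_H10 {Ω : Set (Rd d)} {w : Pair Ω} (hw : w ∈ H10 Ω) :
    IsWeakGradient Ω w.fst w.snd := by
  intro ψ hψ e
  have hcd : Continuous fun x => fderiv ℝ ψ x e :=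
    (hψ.smooth.continuous_fderiv (by simp)).clm_apply continuous_const
  have hcs : HasCompactSupport fun x => fderiv ℝ ψ x e :=
    hψ.hasCompactSupport.fderiv_apply (𝕜 := ℝ) e
  have hg : MemLp (fun x => fderiv ℝ ψ x e) 2 (volume.restrict Ω) :=
    (hcd.memLp_of_hasCompactSupport hcs).restrict Ω
  have hf : MemLp (fun x => ψ x • e) 2 (volume.restrict Ω) := by
    refine MemLp.restrict Ω (Continuous.memLp_of_hasCompactSupport ?_ ?_)
    · exact hψ.smooth.continuous.smul continuous_const
    · exact hψ.hasCompactSupport.smul_right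
  have key : ∀ z : Pair Ω, inner ℝ (hg.toLp _) z.fst + inner ℝ (hf.toLp _) z.snd =
      (∫ x in Ω, z.fst x * fderiv ℝ ψ x e) + ∫ x in Ω, inner ℝ (z.snd x) e * ψ x := by
    intro z
    rw [L2.inner_def, L2.inner_def]
    congr 1
    · refine integral_congr_ae ?_
      filter_upwards [hg.coeFn_toLp] with x hx
      rw [hx]
      simp
    · refine integral_congr_ae ?_
      filter_upwards [hf.coeFn_toLp] with x hx
      rw [hx, real_inner_smul_left, real_inner_comm, mul_comm]
  let F : Pair Ω →L[ℝ] ℝ :=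
    (innerSL ℝ (hg.toLp _)).comp (WithLp.fstL 2 ℝ (L2 Ω) (L2Vec Ω)) +
      (innerSL ℝ (hf.toLp _)).comp (WithLp.sndL 2 ℝ (L2 Ω) (L2Vec Ω))
  have hF : ∀ z : Pair Ω, F z = inner ℝ (hg.toLp _) z.fst + inner ℝ (hf.toLp _) z.snd :=
    fun z => rfl
  have hle : H10 Ω ≤ LinearMap.ker F.toLinearMap := by
    refine Submodule.topologicalClosure_minimal _ (Submodule.span_le.2 ?_)
      (ContinuousLinearMap.isClosed_ker F)
    rintro z ⟨φ, hφ, h1, h2⟩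
    change F z = 0
    rw [hF, key]
    have e1 : ∫ x in Ω, z.fst x * fderiv ℝ ψ x e = ∫ x, φ x * fderiv ℝ ψ x e := by
      rw [← setIntegral_eq_integral_of_forall_compl_eq_zero (s := Ω)
        (f := fun x => φ x * fderiv ℝ ψ x e)]
      · refine integral_congr_ae ?_
        filter_upwards [h1] with x hx
        rw [hx]
      · intro x hx
        rw [image_eq_zero_of_notMem_tsupport fun h => hx (hφ.tsupport_subset h), zero_mul]
    have e2 : ∫ x in Ω, inner ℝ (z.snd x) e * ψ x = ∫ x, fderiv ℝ φ x e * ψ x := by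
      rw [← setIntegral_eq_integral_of_forall_compl_eq_zero (s := Ω)
        (f := fun x => fderiv ℝ φ x e * ψ x)]
      · refine integral_congr_ae ?_
        filter_upwards [h2] with x hx
        rw [hx, gradient, InnerProductSpace.toDual_symm_apply]
      · intro x hx
        rw [image_eq_zero_of_notMem_tsupport fun h => hx (hψ.tsupport_subset h), mul_zero]
    have hcφ : Continuous fun x => fderiv ℝ φ x e :=
      (hφ.smooth.continuous_fderiv (by simp)).clm_apply continuous_const
    rw [e1, e2, integral_mul_fderiv_eq_neg_fderiv_mul_of_integrable]
    · ring
    · exact (hcφ.mul hψ.smooth.continuous).integrable_of_hasCompactSupport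
        hψ.hasCompactSupport.mul_left
    · exact (hφ.smooth.continuous.mul hcd).integrable_of_hasCompactSupport hcs.mul_left
    · exact (hφ.smooth.continuous.mul hψ.smooth.continuous).integrable_of_hasCompactSupport
        hψ.hasCompactSupport.mul_left
    · exact fun x _ => hφ.smooth.differentiable (by simp) x
    · exact fun x _ => hψ.smooth.differentiable (by simp) x
  have h0 : F w = 0 := hle hw
  rw [hF, key] at h0
  linarith

theorem IsWeakGradient.unique {Ω : Set (Rd d)} (hΩ : IsOpen Ω) {v : L2 Ω} {G G' : L2Vec Ω}
    (hG : IsWeakGradient Ω v G) (hG' : IsWeakGradient Ω v G') : G = G' := by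
  have hloc : ∀ K : L2Vec Ω, LocallyIntegrableOn K Ω volume := by
    intro K
    exact locallyIntegrableOn_of_locallyIntegrable_restrict
      ((Lp.memLp K).locallyIntegrable (by norm_num))
  have hae : ∀ᵐ x ∂volume, x ∈ Ω → (G x - G' x) = 0 := by
    refine hΩ.ae_eq_zero_of_integral_contDiff_smul_eq_zero ((hloc G).sub (hloc G')) ?_
    intro ψ h1 h2 h3
    have hψ : IsTestFunction Ω ψ := ⟨h1, h2, h3⟩
    have hb : MemLp ψ 2 (volume.restrict Ω) :=
      (h1.continuous.memLp_of_hasCompactSupport h2).restrict Ω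
    have hint : ∀ K : L2Vec Ω, Integrable (fun x => ψ x • K x) (volume.restrict Ω) :=
      fun K => memLp_one_iff_integrable.1 ((Lp.memLp K).smul hb)
    have hz : (∫ x in Ω, ψ x • G x) = ∫ x in Ω, ψ x • G' x := by
      refine ext_inner_left ℝ fun e => ?_
      rw [← integral_inner (hint G), ← integral_inner (hint G')]
      have := (hG ψ hψ e).symm.trans (hG' ψ hψ e)
      have h : ∀ K : L2Vec Ω, (∫ x in Ω, inner ℝ e (ψ x • K x)) =
          ∫ x in Ω, inner ℝ (K x) e * ψ x := by
        intro K
        refine integral_congr_ae (Filter.Eventually.of_forall fun x => ?_)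
        simp only [real_inner_smul_right, real_inner_comm, mul_comm]
      rw [h, h]
      linarith
    rw [← setIntegral_eq_integral_of_forall_compl_eq_zero (s := Ω)]
    · simp only [smul_sub]
      rw [integral_sub (hint G) (hint G'), hz, sub_self]
    · intro x hx
      rw [image_eq_zero_of_notMem_tsupport fun h => hx (h3 h), zero_smul]
  refine Lp.ext ?_
  filter_upwards [(ae_restrict_iff' hΩ.measurableSet).2 hae] with x hx
  exact sub_eq_zero.1 hx

/-- A mesh of `Ω`: finitely many pairwise disjoint open `d`-simplices contained in `Ω` whose
closures cover `closure Ω`. Hanging nodes are not excluded. -/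
structure Mesh (Ω : Set (Rd d)) where
  /-- the simplices of the mesh -/
  cells : Finset (Affine.Simplex ℝ (Rd d) d)
  interior_subset : ∀ T ∈ cells, T.interior ⊆ Ω
  disjoint : ∀ T ∈ cells, ∀ T' ∈ cells, T ≠ T' → Disjoint T.interior T'.interior
  closure_eq : closure Ω = ⋃ T ∈ cells, T.closedInterior

/-- The finite element space `V_h = {v ∈ H¹₀(Ω) : v|_T ∈ ℙ₁(T) for all T}`. -/
def Vh {Ω : Set (Rd d)} (𝒯 : Mesh Ω) : Submodule ℝ (Pair Ω) where
  carrier := {w | w ∈ H10 Ω ∧ ∀ T ∈ 𝒯.cells, ∃ ℓ : Rd d →ᵃ[ℝ] ℝ,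
    w.fst =ᵐ[volume.restrict T.interior] ℓ}
  zero_mem' := by
    refine ⟨Submodule.zero_mem _, fun T hT => ⟨0, ?_⟩⟩
    exact ae_restrict_of_ae_restrict_of_subset (𝒯.interior_subset T hT)
      (Lp.coeFn_zero ℝ 2 (volume.restrict Ω))
  add_mem' := by
    rintro a b ⟨ha, ha'⟩ ⟨hb, hb'⟩
    refine ⟨Submodule.add_mem _ ha hb, fun T hT => ?_⟩
    obtain ⟨ℓ, h⟩ := ha' T hT
    obtain ⟨m, h'⟩ := hb' T hT
    refine ⟨ℓ + m, ?_⟩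
    have hs := ae_restrict_of_ae_restrict_of_subset (𝒯.interior_subset T hT)
      (Lp.coeFn_add a.fst b.fst)
    filter_upwards [h, h', hs] with x h1 h2 h3
    rw [WithLp.add_fst, h3, Pi.add_apply, h1, h2]
    rfl
  smul_mem' := by
    rintro c a ⟨ha, ha'⟩
    refine ⟨Submodule.smul_mem _ c ha, fun T hT => ?_⟩
    obtain ⟨ℓ, h⟩ := ha' T hT
    refine ⟨c • ℓ, ?_⟩
    have hs := ae_restrict_of_ae_restrict_of_subset (𝒯.interior_subset T hT)
      (Lp.coeFn_smul c a.fst)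
    filter_upwards [h, hs] with x h1 h3
    rw [WithLp.smul_fst, h3, Pi.smul_apply, h1]
    rfl

/-- The bilinear form `a(y, v) = (∇y, ∇v)`. -/
def a {Ω : Set (Rd d)} (y v : Pair Ω) : ℝ := inner ℝ y.snd v.snd

/-- `c` is a coercivity constant of `a` on `H¹₀(Ω)`: `c > 0` and `a(v, v) ≥ c ‖v‖²_{H¹(Ω)}`. -/
def IsCoercivityConstant (Ω : Set (Rd d)) (c : ℝ) : Prop :=
  0 < c ∧ ∀ v ∈ H10 Ω, c * ‖v‖ ^ 2 ≤ a v v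

/-- The `L¹(Ω)` norm. -/
def normL1 {Ω : Set (Rd d)} (v : L2 Ω) : ℝ := ∫ x in Ω, |v x|

/-- `(y, u)` is feasible: `y ∈ V_h` solves the discrete variational inequality
`a(y, v - y) + ‖v‖_{L¹} - ‖y‖_{L¹} ≥ (u, v - y)` for all `v ∈ V_h`. -/
def IsFeasible {Ω : Set (Rd d)} (𝒯 : Mesh Ω) (y : Pair Ω) (u : L2 Ω) : Prop :=
  y ∈ Vh 𝒯 ∧ ∀ v ∈ Vh 𝒯,
    inner ℝ u (v - y).fst ≤ a y (v - y) + normL1 v.fst - normL1 y.fst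

/-- The objective `J(y, u) = ½ ‖y - y_d‖² + ν/2 ‖u - u_d‖²`, with `L²(Ω)` norms. -/
def J {Ω : Set (Rd d)} (ν : ℝ) (yd ud : L2 Ω) (y : Pair Ω) (u : L2 Ω) : ℝ :=
  1 / 2 * ‖y.fst - yd‖ ^ 2 + ν / 2 * ‖u - ud‖ ^ 2

/-- `(ȳ, ū)` is a locally optimal solution of the variationally discretized control problem, local
with respect to the norm of `H¹₀(Ω) × L²(Ω)`. If `ū` minimizes the reduced functional in an
`L²(Ω)` ball and `ȳ` is its discrete state, then this holds a fortiori. -/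
def IsLocalSolution {Ω : Set (Rd d)} (𝒯 : Mesh Ω) (ν : ℝ) (yd ud : L2 Ω)
    (ybar : Pair Ω) (ubar : L2 Ω) : Prop :=
  IsFeasible 𝒯 ybar ubar ∧ ∃ ε > 0, ∀ (y : Pair Ω) (u : L2 Ω), IsFeasible 𝒯 y u →
    ‖y - ybar‖ ≤ ε → ‖u - ubar‖ ≤ ε → J ν yd ud ybar ubar ≤ J ν yd ud y u

end DiscreteVI

end

/-!
With the state `ȳ` held fixed, the feasible controls form a convex set, so local optimality gives
`(p, u - ū) ≥ 0` for `p := ū - u_d` and all controls `u` that are feasible with `ȳ`. Controls that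
differ from `ū` by an element orthogonal to `V_h` are feasible, hence `p ∈ V_h`. Put `w := -p`.
The control `u` with `(u, v) = a(ȳ, v) + (s, v)` on `V_h`, where `s` is the subgradient of the `L¹`
norm at `ȳ` that realizes its derivative in the direction `w`, is feasible as well, and shows that
`w` is a critical direction. Now move the state along `ȳ + t w`. Feasibility is kept by adding to
`ū` a term `t h` that represents `t a(w, ·)` and the `V_h`-projection of the jump
`sign (ȳ + t w) - s`. The jump pairs nonnegatively with `w`, because subgradients are monotone, and
its projection is `O(t)`, because `|ȳ|` takes small nonzero values only on a small set, being
piecewise affine. The first order condition along this curve is `ν a(w, w) ≤ (ȳ - y_d, w)`, and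
coercivity gives the bound.
-/

noncomputable section

open Filter Topology
open scoped NNReal ENNReal

namespace DiscreteVI

/-- The subgradient of `|·|` at `y` that is active in the direction `z`: the limit of
`sign (y + t z)` as `t ↓ 0`. In particular `absSubgrad y 0 = sign y`. -/
def absSubgrad (y z : ℝ) : ℝ := if y = 0 then SignType.sign z else SignType.sign y

lemma abs_absSubgrad_le (y z : ℝ) : |absSubgrad y z| ≤ 1 := by
  have abs_sign_le (x : ℝ) : |(SignType.sign x : ℝ)| ≤ 1 := by
    cases SignType.sign x <;> simp
  unfold absSubgrad
  split_ifs <;> exact abs_sign_le _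

lemma absSubgrad_mul_self (y z : ℝ) : absSubgrad y z * y = |y| := by
  unfold absSubgrad
  split_ifs with h
  · rw [h, mul_zero, abs_zero]
  · exact sign_mul_self y

lemma absSubgrad_mul_sub_le (y z v : ℝ) : absSubgrad y z * (v - y) ≤ |v| - |y| := by
  rw [mul_sub, absSubgrad_mul_self]
  gcongr
  calc absSubgrad y z * v ≤ |absSubgrad y z| * |v| := (le_abs_self _).trans (abs_mul _ _).le
    _ ≤ |v| := mul_le_of_le_one_left (abs_nonneg v) (abs_absSubgrad_le y z)

lemma absSubgrad_mul_right (y z : ℝ) {t : ℝ} (ht : 0 < t) :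
    absSubgrad y (t * z) = absSubgrad y z := by
  simp only [absSubgrad, sign_mul, sign_pos ht, one_mul]

lemma absSubgrad_add_zero_of_imp {y z : ℝ} (h : |y| ≤ |z| → y = 0) :
    absSubgrad (y + z) 0 = absSubgrad y z := by
  by_cases hy : y = 0
  · by_cases hz : z = 0 <;> simp [absSubgrad, hy, hz]
  have hzy : |z| < |y| := not_le.1 fun hle => hy (h hle)
  have sign_add : SignType.sign (y + z) = SignType.sign y := by
    rcases lt_or_gt_of_ne hy with hy | hy
    · rw [abs_of_neg hy, abs_lt] at hzy
      rw [sign_neg hy, sign_neg (by linarith)]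
    · rw [abs_of_pos hy, abs_lt] at hzy
      rw [sign_pos hy, sign_pos (by linarith)]
  have add_ne : y + z ≠ 0 := fun h0 => hzy.ne (by rw [← abs_neg z, ← eq_neg_of_add_eq_zero_left h0])
  simp only [absSubgrad, if_neg hy, if_neg add_ne, sign_add]

lemma tendsto_absSubgrad_add_mul (y z : ℝ) :
    Tendsto (fun t => absSubgrad (y + t * z) 0) (𝓝[>] 0) (𝓝 (absSubgrad y z)) := by
  have small : ∀ᶠ t in 𝓝[>] (0 : ℝ), |y| ≤ |t * z| → y = 0 := by
    by_cases hy : y = 0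
    · exact Eventually.of_forall fun _ _ => hy
    have lim : Tendsto (fun t => |t * z|) (𝓝[>] 0) (𝓝 0) := by
      have : Continuous fun t : ℝ => |t * z| := by fun_prop
      simpa using (this.tendsto 0).mono_left nhdsWithin_le_nhds
    filter_upwards [lim.eventually_lt_const (abs_pos.2 hy)] with t ht hle
    exact absurd hle ht.not_ge
  refine tendsto_const_nhds.congr' ?_
  filter_upwards [small, self_mem_nhdsWithin] with t ht ht0
  rw [absSubgrad_add_zero_of_imp ht, absSubgrad_mul_right y z ht0]

lemma absSubgrad_sub_mul_add_le (y z v : ℝ) :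
    (absSubgrad y v - absSubgrad y z) * v + absSubgrad (y + z) 0 * (v - (y + z)) ≤
      |v| - |y + z| := by
  by_cases hy : y = 0
  · subst hy
    have active (x : ℝ) : absSubgrad 0 x = SignType.sign x := if_pos rfl
    rw [absSubgrad_add_zero_of_imp fun _ => rfl, zero_add, active, active]
    linarith [sign_mul_self v, sign_mul_self z]
  · have passive : absSubgrad y v = absSubgrad y z := by simp only [absSubgrad, if_neg hy]
    rw [passive, sub_self, zero_mul, zero_add]
    exact absSubgrad_mul_sub_le _ _ _

lemma measurable_absSubgrad : Measurable fun p : ℝ × ℝ => absSubgrad p.1 p.2 := by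
  have sign : Measurable fun x : ℝ => (SignType.sign x : ℝ) := by
    simp only [sign_apply, apply_ite ((↑) : SignType → ℝ)]
    exact measurable_const.ite measurableSet_Ioi
      (measurable_const.ite measurableSet_Iio measurable_const)
  exact (sign.comp measurable_snd).ite (measurable_fst (measurableSet_singleton 0))
    (sign.comp measurable_fst)

lemma inner_starProjection_of_mem {H : Type*} [NormedAddCommGroup H] [InnerProductSpace ℝ H]
    {U : Submodule ℝ H} [U.HasOrthogonalProjection] {v : H} (hv : v ∈ U) (w : H) :
    inner ℝ (U.starProjection w) v = inner ℝ w v := by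
  rw [U.inner_starProjection_left_eq_right, Submodule.starProjection_eq_self_iff.2 hv]

section Lp

variable {α : Type*} {m : MeasurableSpace α} {μ : Measure α}

lemma inner_L2_eq_integral_mul (u v : Lp ℝ 2 μ) : inner ℝ u v = ∫ x, u x * v x ∂μ := by
  simp [L2.inner_def, mul_comm]

lemma integrable_L2_mul (u v : Lp ℝ 2 μ) : Integrable (fun x => u x * v x) μ :=
  (Lp.memLp u).integrable_mul (Lp.memLp v)

lemma exists_ae_norm_le_mul_norm {E : Type*} [NormedAddCommGroup E] [NormedSpace ℝ E]
    {p : ℝ≥0∞} [Fact (1 ≤ p)] (U : Submodule ℝ (Lp E p μ)) [FiniteDimensional ℝ U]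
    (hU : ∀ v ∈ U, MemLp v ∞ μ) : ∃ C : ℝ, ∀ v ∈ U, ∀ᵐ x ∂μ, ‖v x‖ ≤ C * ‖v‖ := by
  let toLinfty : U →ₗ[ℝ] Lp E ∞ μ :=
    { toFun v := ⟨v.1, Lp.mem_Lp_iff_memLp.2 (hU v v.2)⟩
      map_add' _ _ := rfl
      map_smul' _ _ := rfl }
  let T : U →L[ℝ] Lp E ∞ μ := LinearMap.toContinuousLinearMap toLinfty
  refine ⟨‖T‖, fun v hv => ?_⟩
  have norm_T : ‖T ⟨v, hv⟩‖ = lpNorm v ∞ μ := toReal_eLpNorm (Lp.aestronglyMeasurable v)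
  filter_upwards [ae_le_lpNorm_exponent_top (hU v hv)] with x hx
  exact (hx.trans_eq norm_T.symm).trans (T.le_opNorm ⟨v, hv⟩)

lemma exists_norm_starProjection_le_mul_integral_abs [IsFiniteMeasure μ]
    (U : Submodule ℝ (Lp ℝ 2 μ)) [FiniteDimensional ℝ U] (hU : ∀ v ∈ U, MemLp v ∞ μ) :
    ∃ C ≥ 0, ∀ g : Lp ℝ 2 μ, ‖U.starProjection g‖ ≤ C * ∫ x, |g x| ∂μ := by
  obtain ⟨C, hC⟩ := exists_ae_norm_le_mul_norm U hU
  refine ⟨max C 0, le_max_right C 0, fun g => ?_⟩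
  set q := U.starProjection g
  have hq : q ∈ U := Submodule.starProjection_apply_mem _ _
  have integrable_g : Integrable g μ := (Lp.memLp g).integrable one_le_two
  have inner_q : inner ℝ g q = ‖q‖ * ‖q‖ := by
    rw [← inner_starProjection_of_mem hq, real_inner_self_eq_norm_mul_norm]
  have bound : ‖q‖ * ‖q‖ ≤ (max C 0 * ∫ x, |g x| ∂μ) * ‖q‖ := by
    calc ‖q‖ * ‖q‖ = ∫ x, g x * q x ∂μ := by rw [← inner_q, inner_L2_eq_integral_mul]
      _ ≤ ∫ x, |g x| * (max C 0 * ‖q‖) ∂μ := by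
          refine integral_mono_ae (integrable_L2_mul g q) (integrable_g.abs.mul_const _) ?_
          filter_upwards [hC q hq] with x hx
          calc g x * q x ≤ |g x| * |q x| := (le_abs_self _).trans (abs_mul _ _).le
            _ ≤ |g x| * (max C 0 * ‖q‖) := by
                gcongr
                exact hx.trans (by gcongr; exact le_max_left _ _)
      _ = (max C 0 * ∫ x, |g x| ∂μ) * ‖q‖ := by rw [integral_mul_const]; ring
  rcases (norm_nonneg q).eq_or_lt with h0 | h0
  · rw [← h0]
    positivity
  · exact le_of_mul_le_mul_right bound h0

/-- Sublevel sets of `v` off its zero set have measure `O(ε)`. This quantifies that a piecewise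
affine function changes sign under a small perturbation only on a small set. -/
def HasThinSublevels (v : α → ℝ) (μ : Measure α) : Prop :=
  ∃ K : ℝ≥0, ∀ ε : ℝ≥0, μ {x | 0 < |v x| ∧ |v x| ≤ ε} ≤ K * ε

lemma HasThinSublevels.congr_ae {v w : α → ℝ} (hv : HasThinSublevels v μ) (h : v =ᵐ[μ] w) :
    HasThinSublevels w μ := by
  obtain ⟨K, hK⟩ := hv
  refine ⟨K, fun ε => (measure_mono_ae ?_).trans (hK ε)⟩
  filter_upwards [h] with x hx hwx
  change 0 < |v x| ∧ |v x| ≤ ε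
  rwa [hx]

lemma hasThinSublevels_const [IsFiniteMeasure μ] (b : ℝ) : HasThinSublevels (fun _ => b) μ := by
  refine ⟨(μ univ).toNNReal / ‖b‖₊, fun ε => ?_⟩
  by_cases hb : 0 < |b| ∧ |b| ≤ ε
  · have one_le : 1 ≤ ε / ‖b‖₊ := (one_le_div hb.1).2 hb.2
    calc μ {_x | 0 < |b| ∧ |b| ≤ ε} ≤ μ univ := measure_mono (subset_univ _)
      _ = ((μ univ).toNNReal * 1 : ℝ≥0) := by
          rw [mul_one, ENNReal.coe_toNNReal (measure_ne_top μ _)]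
      _ ≤ ((μ univ).toNNReal * (ε / ‖b‖₊) : ℝ≥0) := by gcongr
      _ = ((μ univ).toNNReal / ‖b‖₊ : ℝ≥0) * ε := by
          rw [← ENNReal.coe_mul, div_mul_eq_mul_div, mul_div_assoc]
  · simp only [hb, ofPred_false, measure_empty, zero_le]

lemma hasThinSublevels_restrict_biUnion {ι : Type*} {s : Finset ι} {S : ι → Set α} {v : α → ℝ}
    (h : ∀ i ∈ s, HasThinSublevels v (μ.restrict (S i))) :
    HasThinSublevels v (μ.restrict (⋃ i ∈ s, S i)) := by
  choose! K hK using h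
  refine ⟨∑ i ∈ s, K i, fun ε => ?_⟩
  calc μ.restrict (⋃ i ∈ s, S i) {x | 0 < |v x| ∧ |v x| ≤ ε}
      ≤ ∑ i ∈ s, μ.restrict (S i) {x | 0 < |v x| ∧ |v x| ≤ ε} := by
        refine (Measure.restrict_biUnion_le s.countable_toSet _).trans_eq ?_
        rw [Measure.sum_apply_of_countable]
        exact Finset.tsum_subtype s fun i => μ.restrict (S i) {x | 0 < |v x| ∧ |v x| ≤ ε}
    _ ≤ ∑ i ∈ s, (K i : ℝ≥0∞) * ε := Finset.sum_le_sum fun i hi => hK i hi ε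
    _ = ((∑ i ∈ s, K i : ℝ≥0) : ℝ≥0∞) * ε := by rw [← Finset.sum_mul, ENNReal.ofNNReal_finsetSum]

section AbsSubgrad

variable [IsFiniteMeasure μ]

lemma memLp_absSubgrad {y z : α → ℝ} (hy : AEMeasurable y μ) (hz : AEMeasurable z μ) (p : ℝ≥0∞) :
    MemLp (fun x => absSubgrad (y x) (z x)) p μ :=
  .of_bound (measurable_absSubgrad.comp_aemeasurable (hy.prodMk hz)).aestronglyMeasurable 1
    (.of_forall fun _ => abs_absSubgrad_le _ _)

/-- The pointwise subgradient `absSubgrad y z` as an element of `L²`. -/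
def absSubgradL2 (y z : Lp ℝ 2 μ) : Lp ℝ 2 μ :=
  (memLp_absSubgrad (Lp.aestronglyMeasurable y).aemeasurable
    (Lp.aestronglyMeasurable z).aemeasurable 2).toLp _

lemma coeFn_absSubgradL2 (y z : Lp ℝ 2 μ) :
    absSubgradL2 y z =ᵐ[μ] fun x => absSubgrad (y x) (z x) :=
  MemLp.coeFn_toLp _

lemma integrable_abs_sub_abs (u v : Lp ℝ 2 μ) : Integrable (fun x => |u x| - |v x|) μ :=
  ((Lp.memLp u).integrable one_le_two).abs.sub ((Lp.memLp v).integrable one_le_two).abs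

lemma integral_abs_sub_abs (u v : Lp ℝ 2 μ) :
    ∫ x, (|u x| - |v x|) ∂μ = (∫ x, |u x| ∂μ) - ∫ x, |v x| ∂μ :=
  integral_sub ((Lp.memLp u).integrable one_le_two).abs ((Lp.memLp v).integrable one_le_two).abs

lemma inner_absSubgradL2_self (y z : Lp ℝ 2 μ) :
    inner ℝ (absSubgradL2 y z) y = ∫ x, |y x| ∂μ := by
  rw [inner_L2_eq_integral_mul]
  refine integral_congr_ae ?_
  filter_upwards [coeFn_absSubgradL2 y z] with x hx
  rw [hx, absSubgrad_mul_self]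

lemma inner_absSubgradL2_sub_le (y z v : Lp ℝ 2 μ) :
    inner ℝ (absSubgradL2 y z) (v - y) ≤ (∫ x, |v x| ∂μ) - ∫ x, |y x| ∂μ := by
  rw [inner_L2_eq_integral_mul, ← integral_abs_sub_abs]
  refine integral_mono_ae (integrable_L2_mul _ _) (integrable_abs_sub_abs v y) ?_
  filter_upwards [coeFn_absSubgradL2 y z, Lp.coeFn_sub v y] with x hs hsub
  rw [hs, hsub]
  exact absSubgrad_mul_sub_le _ _ _

lemma absSubgradL2_smul_right (y z : Lp ℝ 2 μ) {t : ℝ} (ht : 0 < t) :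
    absSubgradL2 y (t • z) = absSubgradL2 y z := by
  refine Lp.ext ?_
  filter_upwards [coeFn_absSubgradL2 y (t • z), coeFn_absSubgradL2 y z, Lp.coeFn_smul t z]
    with x hl hr hsmul
  rw [hl, hr, hsmul, Pi.smul_apply, smul_eq_mul, absSubgrad_mul_right _ _ ht]

lemma coeFn_absSubgradL2_add_zero (y z : Lp ℝ 2 μ) :
    absSubgradL2 (y + z) 0 =ᵐ[μ] fun x => absSubgrad (y x + z x) 0 := by
  filter_upwards [coeFn_absSubgradL2 (y + z) 0, Lp.coeFn_add y z, Lp.coeFn_zero ℝ 2 μ]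
    with x hs hadd hzero
  rw [hs, hadd, hzero, Pi.add_apply, Pi.zero_apply]

lemma inner_absSubgradL2_jump_nonneg (y z : Lp ℝ 2 μ) :
    0 ≤ inner ℝ (absSubgradL2 (y + z) 0 - absSubgradL2 y z) z := by
  have h₁ := inner_absSubgradL2_sub_le y z (y + z)
  have h₂ := inner_absSubgradL2_sub_le (y + z) 0 y
  rw [add_sub_cancel_left] at h₁
  rw [sub_add_cancel_left, inner_neg_right] at h₂
  rw [inner_sub_left]
  linarith

lemma inner_absSubgradL2_add_inner_jump_le (y z v : Lp ℝ 2 μ) :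
    inner ℝ (absSubgradL2 y v) v - (∫ x, |y x| ∂μ) - inner ℝ (absSubgradL2 y z) z +
        inner ℝ (absSubgradL2 (y + z) 0 - absSubgradL2 y z) (v - (y + z)) ≤
      (∫ x, |v x| ∂μ) - ∫ x, |(y + z) x| ∂μ := by
  have regroup : inner ℝ (absSubgradL2 y v) v - (∫ x, |y x| ∂μ) - inner ℝ (absSubgradL2 y z) z +
        inner ℝ (absSubgradL2 (y + z) 0 - absSubgradL2 y z) (v - (y + z)) =
      inner ℝ (absSubgradL2 y v - absSubgradL2 y z) v +
        inner ℝ (absSubgradL2 (y + z) 0) (v - (y + z)) := by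
    rw [← inner_absSubgradL2_self y z]
    simp only [inner_sub_left, inner_sub_right, inner_add_right]
    ring
  rw [regroup, inner_L2_eq_integral_mul, inner_L2_eq_integral_mul,
    ← integral_add (integrable_L2_mul _ _) (integrable_L2_mul _ _), ← integral_abs_sub_abs]
  refine integral_mono_ae ((integrable_L2_mul _ _).add (integrable_L2_mul _ _))
    (integrable_abs_sub_abs _ _) ?_
  filter_upwards [coeFn_absSubgradL2 y v, coeFn_absSubgradL2 y z, coeFn_absSubgradL2_add_zero y z,
    Lp.coeFn_sub (absSubgradL2 y v) (absSubgradL2 y z), Lp.coeFn_sub v (y + z), Lp.coeFn_add y z]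
    with x hv hz hadd hs hsub hyz
  rw [hs, hsub, Pi.sub_apply, Pi.sub_apply, hv, hz, hadd, hyz]
  exact absSubgrad_sub_mul_add_le _ _ _

lemma tendsto_inner_absSubgradL2_add_smul (y z : Lp ℝ 2 μ) :
    Tendsto (fun t : ℝ => inner ℝ (absSubgradL2 (y + t • z) 0) z) (𝓝[>] 0)
      (𝓝 (inner ℝ (absSubgradL2 y z) z)) := by
  have inner_eq (t : ℝ) : inner ℝ (absSubgradL2 (y + t • z) 0) z =
      ∫ x, absSubgrad (y x + t * z x) 0 * z x ∂μ := by
    rw [inner_L2_eq_integral_mul]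
    refine integral_congr_ae ?_
    filter_upwards [coeFn_absSubgradL2_add_zero y (t • z), Lp.coeFn_smul t z] with x hs hsmul
    rw [hs, hsmul, Pi.smul_apply, smul_eq_mul]
  have inner_eq_lim : inner ℝ (absSubgradL2 y z) z = ∫ x, absSubgrad (y x) (z x) * z x ∂μ := by
    rw [inner_L2_eq_integral_mul]
    exact integral_congr_ae ((coeFn_absSubgradL2 y z).mul EventuallyEq.rfl)
  simp only [inner_eq, inner_eq_lim]
  have aemeas_y : AEMeasurable y μ := (Lp.aestronglyMeasurable y).aemeasurable
  have aemeas_z : AEMeasurable z μ := (Lp.aestronglyMeasurable z).aemeasurable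
  refine tendsto_integral_filter_of_dominated_convergence (fun x => |z x|)
    (.of_forall fun t => ?_) (.of_forall fun t => .of_forall fun x => ?_)
    ((Lp.memLp z).integrable one_le_two).abs
    (.of_forall fun x => (tendsto_absSubgrad_add_mul _ _).mul_const _)
  · exact (memLp_absSubgrad (aemeas_y.add (aemeas_z.const_mul t)) aemeasurable_const
      2).aestronglyMeasurable.mul (Lp.aestronglyMeasurable z)
  · rw [norm_mul]
    exact mul_le_of_le_one_left (norm_nonneg _) (abs_absSubgrad_le _ _)

lemma ae_abs_jump_le_indicator {y z : Lp ℝ 2 μ} {M : ℝ} (hz : ∀ᵐ x ∂μ, |z x| ≤ M) :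
    ∀ᵐ x ∂μ, |(absSubgradL2 (y + z) 0 - absSubgradL2 y z) x| ≤
      {x | 0 < |y x| ∧ |y x| ≤ M}.indicator (fun _ => 2) x := by
  filter_upwards [hz, coeFn_absSubgradL2_add_zero y z, coeFn_absSubgradL2 y z,
    Lp.coeFn_sub (absSubgradL2 (y + z) 0) (absSubgradL2 y z)] with x hx hadd hs hsub
  rw [hsub, Pi.sub_apply, hadd, hs]
  by_cases thin : x ∈ {x | 0 < |y x| ∧ |y x| ≤ M}
  · rw [indicator_of_mem thin]
    refine (abs_sub _ _).trans ?_
    linarith [abs_absSubgrad_le (y x + z x) 0, abs_absSubgrad_le (y x) (z x)]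
  · rw [indicator_of_notMem thin, absSubgrad_add_zero_of_imp, sub_self, abs_zero]
    exact fun hle => by_contra fun hne => thin ⟨abs_pos.2 hne, hle.trans hx⟩

lemma exists_integral_abs_jump_le {y z : Lp ℝ 2 μ} (hy : HasThinSublevels y μ)
    (hz : MemLp z ∞ μ) : ∃ C : ℝ, ∀ t > 0,
      ∫ x, |(absSubgradL2 (y + t • z) 0 - absSubgradL2 y z) x| ∂μ ≤ C * t := by
  obtain ⟨K, hK⟩ := hy
  obtain ⟨M, hM⟩ : ∃ M : ℝ≥0, ∀ᵐ x ∂μ, |z x| ≤ M :=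
    ⟨⟨lpNorm z ∞ μ, lpNorm_nonneg⟩, ae_le_lpNorm_exponent_top hz⟩
  refine ⟨2 * K * M, fun t ht => ?_⟩
  lift t to ℝ≥0 using ht.le
  set S : Set α := {x | 0 < |y x| ∧ |y x| ≤ (t * M : ℝ≥0)}
  have measurableSet_S : MeasurableSet S := by
    have hmeas := (Lp.stronglyMeasurable y).measurable.abs
    exact (measurableSet_lt measurable_const hmeas).inter (measurableSet_le hmeas measurable_const)
  have abs_smul_le : ∀ᵐ x ∂μ, |((t : ℝ) • z) x| ≤ (t * M : ℝ≥0) := by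
    filter_upwards [hM, Lp.coeFn_smul (t : ℝ) z] with x hx hsmul
    rw [hsmul, Pi.smul_apply, smul_eq_mul, abs_mul, abs_of_pos ht, NNReal.coe_mul]
    gcongr
  rw [← absSubgradL2_smul_right y z ht]
  calc ∫ x, |(absSubgradL2 (y + (t : ℝ) • z) 0 - absSubgradL2 y ((t : ℝ) • z)) x| ∂μ
      ≤ ∫ x, S.indicator (fun _ => 2) x ∂μ :=
        integral_mono_ae ((Lp.memLp _).integrable one_le_two).abs
          ((integrable_const _).indicator measurableSet_S) (ae_abs_jump_le_indicator abs_smul_le)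
    _ = μ.real S * 2 := by
        rw [integral_indicator measurableSet_S, setIntegral_const, smul_eq_mul]
    _ ≤ (K * (t * M) : ℝ≥0) * 2 := by
        gcongr
        exact ENNReal.toReal_le_coe_of_le_coe ((hK (t * M)).trans_eq (ENNReal.coe_mul _ _).symm)
    _ = 2 * K * M * t := by
        push_cast
        ring

end AbsSubgrad

end Lp

lemma integrable_norm_sq_of_hasCompactSupport {X F : Type*} [TopologicalSpace X]
    [MeasurableSpace X] [OpensMeasurableSpace X] (μ : Measure X) [IsFiniteMeasureOnCompacts μ]
    [NormedAddCommGroup F] {f : X → F} (hf : Continuous f) (hsupp : HasCompactSupport f) :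
    Integrable (fun x => ‖f x‖ ^ 2) μ := by
  have hsupp_sq : HasCompactSupport fun x => ‖f x‖ ^ 2 :=
    hsupp.comp_left (g := fun v => ‖v‖ ^ 2) (by simp)
  exact (hf.norm.pow 2).integrable_of_hasCompactSupport hsupp_sq

lemma neg_mul_fderiv_mul_le {E : Type*} [NormedAddCommGroup E] [NormedSpace ℝ E] {φ : E → ℝ}
    {R : ℝ} (hR : tsupport φ ⊆ Metric.closedBall 0 R) {e : E} (he : ‖e‖ = 1) {L : E →L[ℝ] ℝ}
    (hL : ‖L‖ = 1) (x : E) :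
    -(2 * φ x * fderiv ℝ φ x e * L x) ≤ 1 / 2 * φ x ^ 2 + 2 * R ^ 2 * ‖fderiv ℝ φ x‖ ^ 2 := by
  by_cases hx : x ∈ tsupport φ
  · have abs_L_le : |L x| ≤ R := by
      simpa [hL] using (L.le_opNorm x).trans
        (mul_le_mul_of_nonneg_left (mem_closedBall_zero_iff.1 (hR hx)) (norm_nonneg L))
    have abs_fderiv_le : |fderiv ℝ φ x e| ≤ ‖fderiv ℝ φ x‖ := by
      simpa [he] using (fderiv ℝ φ x).le_opNorm e
    have abs_le : |fderiv ℝ φ x e * L x| ≤ ‖fderiv ℝ φ x‖ * R := by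
      rw [abs_mul]
      gcongr
    have sq_le := sq_le_sq.2 (abs_le.trans (le_abs_self _))
    linarith [sq_nonneg (φ x + 2 * (fderiv ℝ φ x e * L x))]
  · rw [image_eq_zero_of_notMem_tsupport hx]
    simp only [mul_zero, zero_mul, neg_zero]
    positivity

section HaarMeasure

variable {E : Type*} [NormedAddCommGroup E] [NormedSpace ℝ E] [MeasurableSpace E] [BorelSpace E]
  (μ : Measure E)

lemma integrable_mul_fderiv_mul [IsFiniteMeasureOnCompacts μ] {φ : E → ℝ} (hφ : ContDiff ℝ 1 φ)
    (hsupp : HasCompactSupport φ) (e : E) (L : E →L[ℝ] ℝ) :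
    Integrable (fun x => 2 * φ x * fderiv ℝ φ x e * L x) μ := by
  have continuous_fderiv : Continuous fun x => fderiv ℝ φ x e :=
    (hφ.continuous_fderiv one_ne_zero).clm_apply continuous_const
  exact (((continuous_const.mul hφ.continuous).mul continuous_fderiv).mul
    L.continuous).integrable_of_hasCompactSupport hsupp.mul_left.mul_right.mul_right

variable [FiniteDimensional ℝ E] [μ.IsAddHaarMeasure]

lemma exists_measure_inter_preimage_le {L : E →L[ℝ] ℝ} (hL : L ≠ 0) {B : Set E}
    (hB : Bornology.IsBounded B) : ∃ K : ℝ≥0, ∀ s, μ (B ∩ L ⁻¹' s) ≤ K * volume s := by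
  obtain ⟨e, he⟩ : ∃ e, L e = 1 := by
    refine LinearMap.surjective (f := L.toLinearMap) ?_ 1
    exact fun h => hL (ContinuousLinearMap.coe_injective h)
  let split : E ≃L[ℝ] ℝ × L.ker :=
    .equivOfRightInverse L (.toSpanSingleton ℝ e) fun t => by simp [he]
  obtain ⟨R, hR⟩ := (split.lipschitz.isBounded_image hB).subset_closedBall 0
  let ν : Measure L.ker := Measure.addHaar
  obtain ⟨c, hμ⟩ : ∃ c : ℝ≥0, μ.map split = c • volume.prod ν :=
    ⟨_, Measure.isAddLeftInvariant_eq_smul _ _⟩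
  refine ⟨c * (ν (Metric.closedBall 0 R)).toNNReal, fun s => ?_⟩
  calc μ (B ∩ L ⁻¹' s) ≤ μ (split ⁻¹' (s ×ˢ Metric.closedBall 0 R)) := by
        refine measure_mono fun x hx => ⟨?_, ?_⟩
        · rw [ContinuousLinearEquiv.fst_equivOfRightInverse]
          exact hx.2
        · have := hR (mem_image_of_mem split hx.1)
          rw [mem_closedBall_zero_iff] at this ⊢
          exact (norm_snd_le _).trans this
    _ = (c • volume.prod ν) (s ×ˢ Metric.closedBall 0 R) := by
        rw [← hμ]
        exact (split.toHomeomorph.toMeasurableEquiv.map_apply _).symm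
    _ = (c * (ν (Metric.closedBall 0 R)).toNNReal : ℝ≥0) * volume s := by
        rw [Measure.smul_apply, Measure.prod_prod, ENNReal.smul_def, smul_eq_mul, ENNReal.coe_mul,
          ENNReal.coe_toNNReal measure_closedBall_lt_top.ne]
        ring

lemma hasThinSublevels_restrict_affineMap (ℓ : E →ᵃ[ℝ] ℝ) {B : Set E}
    (hB : Bornology.IsBounded B) : HasThinSublevels ℓ (μ.restrict B) := by
  have continuous_ℓ : Continuous ℓ := ℓ.continuous_of_finiteDimensional
  let L : E →L[ℝ] ℝ := LinearMap.toContinuousLinearMap ℓ.linear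
  have ℓ_apply (x : E) : ℓ x = L x + ℓ 0 := congrFun ℓ.decomp x
  by_cases hL : L = 0
  · have : IsFiniteMeasure (μ.restrict B) := isFiniteMeasure_restrict.2 hB.measure_lt_top.ne
    exact (hasThinSublevels_const (ℓ 0)).congr_ae (.of_forall fun x => by simp [ℓ_apply x, hL])
  · obtain ⟨K, hK⟩ := exists_measure_inter_preimage_le μ hL hB
    refine ⟨K * 2, fun ε => ?_⟩
    have measurableSet_slab : MeasurableSet {x | 0 < |ℓ x| ∧ |ℓ x| ≤ ε} :=
      (measurableSet_lt measurable_const continuous_ℓ.abs.measurable).inter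
        (measurableSet_le continuous_ℓ.abs.measurable measurable_const)
    calc μ.restrict B {x | 0 < |ℓ x| ∧ |ℓ x| ≤ ε}
        ≤ μ (B ∩ L ⁻¹' Metric.closedBall (-ℓ 0) ε) := by
          rw [Measure.restrict_apply measurableSet_slab, inter_comm]
          refine measure_mono (inter_subset_inter_right _ fun x hx => ?_)
          rw [mem_preimage, Metric.mem_closedBall, Real.dist_eq, sub_neg_eq_add, ← ℓ_apply]
          exact hx.2
      _ ≤ K * volume (Metric.closedBall (-ℓ 0) ε) := hK _
      _ = (K * 2 : ℝ≥0) * ε := by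
          rw [Real.volume_closedBall, ENNReal.ofReal_mul zero_le_two, ENNReal.ofReal_coe_nnreal]
          push_cast
          rw [ENNReal.ofReal_ofNat, mul_assoc]

lemma integral_sq_eq_neg_integral_mul_fderiv_mul {φ : E → ℝ} (hφ : ContDiff ℝ 1 φ)
    (hsupp : HasCompactSupport φ) {e : E} {L : E →L[ℝ] ℝ} (hL : L e = 1) :
    ∫ x, φ x ^ 2 ∂μ = -∫ x, 2 * φ x * fderiv ℝ φ x e * L x ∂μ := by
  have hdiff : Differentiable ℝ φ := hφ.differentiable one_ne_zero
  have fderiv_sq (x : E) : fderiv ℝ (fun x => φ x ^ 2) x e = 2 * φ x * fderiv ℝ φ x e := by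
    simp [fderiv_fun_pow _ (hdiff x)]
  have fderiv_L (x : E) : fderiv ℝ L x e = 1 := by rw [L.fderiv, hL]
  have hsupp_sq : HasCompactSupport fun x => φ x ^ 2 :=
    hsupp.comp_left (g := fun t => t ^ 2) (zero_pow two_ne_zero)
  have by_parts := integral_mul_fderiv_eq_neg_fderiv_mul_of_integrable (μ := μ)
    (f := fun x => φ x ^ 2) (g := L) (v := e) ?_ ?_ ?_ (fun x _ => (hdiff x).fun_pow 2)
    (fun x _ => L.differentiableAt)
  · simpa only [fderiv_L, mul_one, fderiv_sq] using by_parts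
  · simpa only [fderiv_sq] using integrable_mul_fderiv_mul μ hφ hsupp e L
  · simp only [fderiv_L, mul_one]
    exact (hφ.continuous.pow 2).integrable_of_hasCompactSupport hsupp_sq
  · exact ((hφ.continuous.pow 2).mul L.continuous).integrable_of_hasCompactSupport
      hsupp_sq.mul_right

lemma integral_sq_le_mul_integral_norm_fderiv_sq [Nontrivial E] {φ : E → ℝ} (hφ : ContDiff ℝ 1 φ)
    {R : ℝ} (hR : tsupport φ ⊆ Metric.closedBall 0 R) :
    ∫ x, φ x ^ 2 ∂μ ≤ 4 * R ^ 2 * ∫ x, ‖fderiv ℝ φ x‖ ^ 2 ∂μ := by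
  have hsupp : HasCompactSupport φ :=
    (isCompact_closedBall 0 R).of_isClosed_subset (isClosed_tsupport φ) hR
  obtain ⟨e, norm_e⟩ : ∃ e : E, ‖e‖ = 1 := exists_norm_eq E zero_le_one
  obtain ⟨L, norm_L, L_e⟩ := exists_dual_vector ℝ e (by simp [norm_e])
  rw [norm_e, RCLike.ofReal_one] at L_e
  have integrable_sq : Integrable (fun x => φ x ^ 2) μ := by
    simpa only [Real.norm_eq_abs, sq_abs] using
      integrable_norm_sq_of_hasCompactSupport μ hφ.continuous hsupp
  have integrable_fderiv_sq : Integrable (fun x => ‖fderiv ℝ φ x‖ ^ 2) μ :=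
    integrable_norm_sq_of_hasCompactSupport μ (hφ.continuous_fderiv one_ne_zero)
      (hsupp.fderiv (𝕜 := ℝ))
  have half : ∫ x, φ x ^ 2 ∂μ ≤
      1 / 2 * ∫ x, φ x ^ 2 ∂μ + 2 * R ^ 2 * ∫ x, ‖fderiv ℝ φ x‖ ^ 2 ∂μ :=
    calc ∫ x, φ x ^ 2 ∂μ = ∫ x, -(2 * φ x * fderiv ℝ φ x e * L x) ∂μ := by
          rw [integral_neg, ← integral_sq_eq_neg_integral_mul_fderiv_mul μ hφ hsupp L_e]
      _ ≤ ∫ x, (1 / 2 * φ x ^ 2 + 2 * R ^ 2 * ‖fderiv ℝ φ x‖ ^ 2) ∂μ :=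
          integral_mono (integrable_mul_fderiv_mul μ hφ hsupp e L).neg
            ((integrable_sq.const_mul _).add (integrable_fderiv_sq.const_mul _))
            (neg_mul_fderiv_mul_le hR norm_e norm_L)
      _ = 1 / 2 * ∫ x, φ x ^ 2 ∂μ + 2 * R ^ 2 * ∫ x, ‖fderiv ℝ φ x‖ ^ 2 ∂μ := by
          rw [integral_add (integrable_sq.const_mul _) (integrable_fderiv_sq.const_mul _),
            integral_const_mul, integral_const_mul]
  linarith

end HaarMeasure

lemma norm_sq_eq_integral_norm_sq {α F : Type*} {m : MeasurableSpace α} {μ : Measure α} {Ω : Set α}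
    [NormedAddCommGroup F] [InnerProductSpace ℝ F] {f : Lp F 2 (μ.restrict Ω)} {φ : α → F}
    (hf : f =ᵐ[μ.restrict Ω] φ) (hφ : ∀ x ∉ Ω, φ x = 0) : ‖f‖ ^ 2 = ∫ x, ‖φ x‖ ^ 2 ∂μ := by
  rw [← real_inner_self_eq_norm_sq, L2.inner_def,
    ← setIntegral_eq_integral_of_forall_compl_eq_zero (s := Ω) (f := fun x => ‖φ x‖ ^ 2)
      fun x hx => by simp [hφ x hx]]
  refine integral_congr_ae ?_
  filter_upwards [hf] with x hx
  rw [hx, real_inner_self_eq_norm_sq]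

section Coercivity

variable {d : ℕ} {Ω : Set (Rd d)} {φ ψ : Rd d → ℝ}

lemma IsTestFunction.differentiable (hφ : IsTestFunction Ω φ) : Differentiable ℝ φ :=
  hφ.smooth.differentiable (by simp)

lemma IsTestFunction.zero : IsTestFunction Ω (0 : Rd d → ℝ) :=
  ⟨contDiff_const, .zero, by simp [tsupport_eq_empty_iff.2 rfl]⟩

lemma IsTestFunction.add (hφ : IsTestFunction Ω φ) (hψ : IsTestFunction Ω ψ) :
    IsTestFunction Ω (φ + ψ) :=
  ⟨hφ.smooth.add hψ.smooth, hφ.hasCompactSupport.add hψ.hasCompactSupport,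
    (tsupport_add φ ψ).trans (union_subset hφ.tsupport_subset hψ.tsupport_subset)⟩

lemma IsTestFunction.const_smul (hφ : IsTestFunction Ω φ) (c : ℝ) : IsTestFunction Ω (c • φ) :=
  ⟨contDiff_const.smul hφ.smooth, hφ.hasCompactSupport.smul_left,
    (tsupport_smul_subset_right (fun _ => c) φ).trans hφ.tsupport_subset⟩

lemma span_testPairs : (Submodule.span ℝ (testPairs Ω) : Set (Pair Ω)) = testPairs Ω := by
  refine subset_antisymm (fun w hw => ?_) Submodule.subset_span
  induction hw using Submodule.span_induction with
  | mem _ hw => exact hw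
  | zero =>
    refine ⟨0, .zero, Lp.coeFn_zero ℝ 2 _, ?_⟩
    filter_upwards [Lp.coeFn_zero (Rd d) 2 (volume.restrict Ω)] with x hx
    rw [WithLp.zero_snd, hx, gradient, fderiv_zero, Pi.zero_apply, Pi.zero_apply, map_zero]
  | add v w _ _ hv hw =>
    obtain ⟨φ, hφ, hv₁, hv₂⟩ := hv
    obtain ⟨ψ, hψ, hw₁, hw₂⟩ := hw
    refine ⟨φ + ψ, hφ.add hψ, (Lp.coeFn_add v.fst w.fst).trans (hv₁.add hw₁), ?_⟩
    filter_upwards [hv₂, hw₂, Lp.coeFn_add v.snd w.snd] with x hvx hwx hadd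
    rw [WithLp.add_snd, hadd, Pi.add_apply, hvx, hwx, gradient, gradient, gradient,
      fderiv_add (hφ.differentiable x) (hψ.differentiable x), map_add]
  | smul c w _ hw =>
    obtain ⟨φ, hφ, hw₁, hw₂⟩ := hw
    refine ⟨c • φ, hφ.const_smul c, (Lp.coeFn_smul c w.fst).trans (hw₁.const_smul c), ?_⟩
    filter_upwards [hw₂, Lp.coeFn_smul c w.snd] with x hwx hsmul
    rw [WithLp.smul_snd, hsmul, Pi.smul_apply, hwx, gradient, gradient,
      fderiv_const_smul (hφ.differentiable x), map_smul]

lemma norm_fst_sq_le_of_mem_H10 [NeZero d] {R : ℝ} (hR : Ω ⊆ Metric.closedBall 0 R) {w : Pair Ω}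
    (hw : w ∈ H10 Ω) : ‖w.fst‖ ^ 2 ≤ 4 * R ^ 2 * ‖w.snd‖ ^ 2 := by
  have isClosed_le : IsClosed {w : Pair Ω | ‖w.fst‖ ^ 2 ≤ 4 * R ^ 2 * ‖w.snd‖ ^ 2} :=
    isClosed_le ((WithLp.fstL 2 ℝ (L2 Ω) (L2Vec Ω)).continuous.norm.pow 2)
      (continuous_const.mul ((WithLp.sndL 2 ℝ (L2 Ω) (L2Vec Ω)).continuous.norm.pow 2))
  refine closure_minimal (fun z hz => ?_) isClosed_le hw
  obtain ⟨φ, hφ, hz₁, hz₂⟩ := span_testPairs.subset hz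
  have norm_gradient (x : Rd d) : ‖gradient φ x‖ = ‖fderiv ℝ φ x‖ :=
    LinearIsometryEquiv.norm_map _ _
  calc ‖z.fst‖ ^ 2 = ∫ x, φ x ^ 2 := by
        rw [norm_sq_eq_integral_norm_sq hz₁ fun x hx =>
          image_eq_zero_of_notMem_tsupport fun h => hx (hφ.tsupport_subset h)]
        simp only [Real.norm_eq_abs, sq_abs]
    _ ≤ 4 * R ^ 2 * ∫ x, ‖fderiv ℝ φ x‖ ^ 2 :=
        integral_sq_le_mul_integral_norm_fderiv_sq volume (hφ.smooth.of_le (by simp))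
          (hφ.tsupport_subset.trans hR)
    _ = 4 * R ^ 2 * ‖z.snd‖ ^ 2 := by
        rw [norm_sq_eq_integral_norm_sq hz₂ fun x hx => ?_]
        · simp only [norm_gradient]
        · rw [← norm_eq_zero, norm_gradient, norm_eq_zero]
          exact image_eq_zero_of_notMem_tsupport fun h =>
            hx (hφ.tsupport_subset (tsupport_fderiv_subset ℝ h))

lemma exists_isCoercivityConstant [NeZero d] (hΩ : Bornology.IsBounded Ω) :
    ∃ c : ℝ, IsCoercivityConstant Ω c := by
  obtain ⟨R, hR⟩ := hΩ.subset_closedBall 0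
  refine ⟨(4 * R ^ 2 + 1)⁻¹, by positivity, fun v hv => ?_⟩
  rw [a, real_inner_self_eq_norm_sq, WithLp.prod_norm_sq_eq_of_L2,
    inv_mul_le_iff₀ (by positivity)]
  linarith [norm_fst_sq_le_of_mem_H10 hR hv]

lemma IsCoercivityConstant.norm_le {c ν : ℝ} (hc : IsCoercivityConstant Ω c) (hν : 0 < ν)
    {w : Pair Ω} (hw : w ∈ H10 Ω) {f : L2 Ω} (h : ν * a w w ≤ inner ℝ f w.fst) :
    ‖w‖ ≤ 1 / (ν * c) * ‖f‖ := by
  have hνc : 0 < ν * c := mul_pos hν hc.1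
  rw [one_div, le_inv_mul_iff₀ hνc]
  rcases (norm_nonneg w).eq_or_lt with norm_eq | norm_pos
  · rw [← norm_eq, mul_zero]
    positivity
  refine le_of_mul_le_mul_right ?_ norm_pos
  calc ν * c * ‖w‖ * ‖w‖ = ν * (c * ‖w‖ ^ 2) := by ring
    _ ≤ ν * a w w := by gcongr; exact hc.2 w hw
    _ ≤ ‖f‖ * ‖w.fst‖ := h.trans (real_inner_le_norm _ _)
    _ ≤ ‖f‖ * ‖w‖ := by gcongr; exact WithLp.norm_fst_le _ w

end Coercivity

lemma addHaar_faceOpposite_closedInterior {E : Type*} [NormedAddCommGroup E] [NormedSpace ℝ E]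
    [FiniteDimensional ℝ E] [MeasurableSpace E] [BorelSpace E] (μ : Measure E) [μ.IsAddHaarMeasure]
    {n : ℕ} [NeZero n] (T : Affine.Simplex ℝ E n) (i : Fin (n + 1)) :
    μ (T.faceOpposite i).closedInterior = 0 := by
  refine measure_mono_null (T.faceOpposite i).closedInterior_subset_affineSpan
    (Measure.addHaar_affineSubspace _ _ fun span_eq_top => ?_)
  have finrank_face := (T.faceOpposite i).independent.finrank_vectorSpan (Fintype.card_fin _)
  have finrank_simplex := T.independent.finrank_vectorSpan (Fintype.card_fin _)
  rw [← direction_affineSpan, span_eq_top, AffineSubspace.direction_top, finrank_top]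
    at finrank_face
  have le_finrank := (vectorSpan ℝ (range T.points)).finrank_le
  have := NeZero.pos n
  omega

lemma interior_ae_eq_closedInterior {E : Type*} [NormedAddCommGroup E] [NormedSpace ℝ E]
    [FiniteDimensional ℝ E] [MeasurableSpace E] [BorelSpace E] (μ : Measure E) [μ.IsAddHaarMeasure]
    {n : ℕ} [NeZero n] (T : Affine.Simplex ℝ E n) : T.interior =ᵐ[μ] T.closedInterior := by
  rw [T.closedInterior_eq_interior_union]
  exact (union_ae_eq_left_of_ae_eq_empty (ae_eq_empty.2
    (measure_iUnion_null fun i => addHaar_faceOpposite_closedInterior μ T i))).symm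

section Mesh

variable {d : ℕ} {Ω : Set (Rd d)}

/-- The image of `V_h` in `L²(Ω)`, that is, `V_h` without the recorded weak gradients. -/
def VhFst (𝒯 : Mesh Ω) : Submodule ℝ (L2 Ω) :=
  (Vh 𝒯).map (WithLp.fstL 2 ℝ (L2 Ω) (L2Vec Ω)).toLinearMap

lemma fst_mem_VhFst {𝒯 : Mesh Ω} {w : Pair Ω} (hw : w ∈ Vh 𝒯) : w.fst ∈ VhFst 𝒯 :=
  Submodule.mem_map_of_mem hw

lemma Mesh.isBounded (𝒯 : Mesh Ω) : Bornology.IsBounded Ω := by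
  refine Bornology.IsBounded.subset ?_ subset_closure
  rw [𝒯.closure_eq]
  exact (Finset.isCompact_biUnion _ fun T _ => T.isCompact_closedInterior).isBounded

lemma Mesh.isFiniteMeasure_restrict (𝒯 : Mesh Ω) : IsFiniteMeasure (volume.restrict Ω) :=
  MeasureTheory.isFiniteMeasure_restrict.2 𝒯.isBounded.measure_lt_top.ne

lemma Mesh.isBounded_interior (𝒯 : Mesh Ω) {T : Affine.Simplex ℝ (Rd d) d} (hT : T ∈ 𝒯.cells) :
    Bornology.IsBounded T.interior :=
  𝒯.isBounded.subset (𝒯.interior_subset T hT)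

variable [NeZero d]

lemma Mesh.restrict_biUnion_interior (𝒯 : Mesh Ω) :
    volume.restrict (⋃ T ∈ 𝒯.cells, T.interior) = volume.restrict Ω := by
  refine Measure.restrict_congr_set (EventuallyLE.antisymm
    (iUnion₂_subset 𝒯.interior_subset).eventuallyLE ?_)
  have closure_ae_eq : closure Ω =ᵐ[volume] ⋃ T ∈ 𝒯.cells, T.interior := by
    rw [𝒯.closure_eq]
    exact 𝒯.cells.eventuallyEq_iUnion fun T _ => (interior_ae_eq_closedInterior volume T).symm
  exact subset_closure.eventuallyLE.trans closure_ae_eq.le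

lemma Mesh.ae_restrict_iff (𝒯 : Mesh Ω) {p : Rd d → Prop} :
    (∀ᵐ x ∂volume.restrict Ω, p x) ↔
      ∀ T ∈ 𝒯.cells, ∀ᵐ x ∂volume.restrict T.interior, p x := by
  rw [← 𝒯.restrict_biUnion_interior, ae_restrict_biUnion_finset_iff]

variable {𝒯 : Mesh Ω}

lemma hasThinSublevels_of_mem_Vh {w : Pair Ω} (hw : w ∈ Vh 𝒯) :
    HasThinSublevels w.fst (volume.restrict Ω) := by
  have thin_union :
      HasThinSublevels w.fst (volume.restrict (⋃ T ∈ 𝒯.cells, T.interior)) := by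
    refine hasThinSublevels_restrict_biUnion fun T hT => ?_
    obtain ⟨ℓ, hℓ⟩ := hw.2 T hT
    exact (hasThinSublevels_restrict_affineMap volume ℓ (𝒯.isBounded_interior hT)).congr_ae hℓ.symm
  generalize (w.fst : Rd d → ℝ) = f at thin_union ⊢
  rwa [𝒯.restrict_biUnion_interior] at thin_union

lemma memLp_top_of_mem_Vh {w : Pair Ω} (hw : w ∈ Vh 𝒯) : MemLp w.fst ∞ (volume.restrict Ω) := by
  have bounded_on_cell : ∀ T ∈ 𝒯.cells, ∃ C, ∀ᵐ x ∂volume.restrict T.interior, ‖w.fst x‖ ≤ C := by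
    intro T hT
    obtain ⟨ℓ, hℓ⟩ := hw.2 T hT
    obtain ⟨C, hC⟩ := T.isCompact_closedInterior.exists_bound_of_continuousOn
      ℓ.continuous_of_finiteDimensional.continuousOn
    have restrict_eq := Measure.restrict_congr_set (interior_ae_eq_closedInterior volume T)
    refine ⟨C, ?_⟩
    rw [restrict_eq] at hℓ ⊢
    filter_upwards [hℓ, ae_restrict_mem T.isClosed_closedInterior.measurableSet] with x hx hxT
    rw [hx]
    exact hC x hxT
  choose! C hC using bounded_on_cell
  obtain ⟨M, hM⟩ := (𝒯.cells.image C).exists_le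
  refine memLp_top_of_bound (Lp.aestronglyMeasurable _) M (𝒯.ae_restrict_iff.2 fun T hT => ?_)
  filter_upwards [hC T hT] with x hx
  exact hx.trans (hM _ (Finset.mem_image_of_mem C hT))

/-- The pairs `(v, ℓ)` of a function `v` and a family `ℓ` of affine functions, one for each cell,
that agree with `v` on their cells. Since `ℓ` determines `v`, this space is finite dimensional. -/
def piecewiseAffineGraph (𝒯 : Mesh Ω) : Submodule ℝ (L2 Ω × (𝒯.cells → Rd d →ᵃ[ℝ] ℝ)) where
  carrier := {p | ∀ T : 𝒯.cells, p.1 =ᵐ[volume.restrict T.1.interior] p.2 T}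
  zero_mem' T := ae_restrict_of_ae_restrict_of_subset (𝒯.interior_subset T T.2)
    (Lp.coeFn_zero ℝ 2 (volume.restrict Ω))
  add_mem' {p q} hp hq T :=
    EventuallyEq.trans (ae_restrict_of_ae_restrict_of_subset (𝒯.interior_subset T T.2)
      (Lp.coeFn_add p.1 q.1)) ((hp T).add (hq T))
  smul_mem' c p hp T :=
    EventuallyEq.trans (ae_restrict_of_ae_restrict_of_subset (𝒯.interior_subset T T.2)
      (Lp.coeFn_smul c p.1)) ((hp T).const_smul c)

lemma finiteDimensional_piecewiseAffineGraph :
    FiniteDimensional ℝ (piecewiseAffineGraph 𝒯) := by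
  refine Module.Finite.of_injective
    ((LinearMap.snd ℝ (L2 Ω) (𝒯.cells → Rd d →ᵃ[ℝ] ℝ)).domRestrict (piecewiseAffineGraph 𝒯)) ?_
  rintro ⟨⟨v, ℓ⟩, hv⟩ ⟨⟨v', ℓ'⟩, hv'⟩ rfl
  suffices v = v' by subst this; rfl
  exact Lp.ext (𝒯.ae_restrict_iff.2 fun T hT => (hv ⟨T, hT⟩).trans (hv' ⟨T, hT⟩).symm)

instance finiteDimensional_VhFst : FiniteDimensional ℝ (VhFst 𝒯) := by
  have := finiteDimensional_piecewiseAffineGraph (𝒯 := 𝒯)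
  suffices VhFst 𝒯 ≤ (piecewiseAffineGraph 𝒯).map (LinearMap.fst ℝ _ _) from
    Submodule.finiteDimensional_of_le this
  rintro _ ⟨w, hw, rfl⟩
  choose! ℓ hℓ using hw.2
  exact ⟨(w.fst, fun T => ℓ T), fun T => hℓ T T.2, rfl⟩

end Mesh

lemma exists_inner_map_eq {V H : Type*} [AddCommGroup V] [Module ℝ V]
    [NormedAddCommGroup H] [InnerProductSpace ℝ H] {U : Submodule ℝ V} {f : V →ₗ[ℝ] H}
    [FiniteDimensional ℝ (U.map f)] (hf : Function.Injective (f.domRestrict U)) (g : V →ₗ[ℝ] ℝ) :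
    ∃ h : H, ∀ v ∈ U, inner ℝ h (f v) = g v := by
  obtain ⟨k, hk⟩ := LinearMap.exists_leftInverse_of_injective _ (LinearMap.ker_eq_bot.2 hf)
  let φ : StrongDual ℝ (U.map f) :=
    LinearMap.toContinuousLinearMap (g ∘ₗ U.subtype ∘ₗ k ∘ₗ (U.map f).subtype)
  let h : U.map f := (InnerProductSpace.toDual ℝ (U.map f)).symm φ
  refine ⟨h, fun v hv => ?_⟩
  let fv : U.map f := ⟨f v, Submodule.mem_map_of_mem hv⟩
  calc inner ℝ h fv = φ fv := InnerProductSpace.toDual_symm_apply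
    _ = g v := congrArg (fun u : U => g u) (LinearMap.congr_fun hk ⟨v, hv⟩)

section Optimality

variable {d : ℕ} {Ω : Set (Rd d)} {𝒯 : Mesh Ω} {ν : ℝ} {yd ud : L2 Ω} {y ybar : Pair Ω}
  {u ubar : L2 Ω}

lemma eq_zero_of_mem_H10_of_fst_eq_zero (hΩ : IsOpen Ω) {w : Pair Ω} (hw : w ∈ H10 Ω)
    (h : w.fst = 0) : w = 0 := by
  have grad_w := isWeakGradient_of_mem_H10 hw
  have grad_zero := isWeakGradient_of_mem_H10 (H10 Ω).zero_mem
  rw [h] at grad_w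
  exact WithLp.ofLp_injective 2 (Prod.ext h (grad_w.unique hΩ grad_zero))

lemma exists_inner_fst_eq_a [NeZero d] (hΩ : IsOpen Ω) (𝒯 : Mesh Ω) (y : Pair Ω) :
    ∃ h : L2 Ω, ∀ v ∈ Vh 𝒯, inner ℝ h v.fst = a y v := by
  have : FiniteDimensional ℝ ((Vh 𝒯).map (WithLp.fstL 2 ℝ (L2 Ω) (L2Vec Ω)).toLinearMap) :=
    finiteDimensional_VhFst
  refine exists_inner_map_eq (U := Vh 𝒯) (f := (WithLp.fstL 2 ℝ (L2 Ω) (L2Vec Ω)).toLinearMap)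
    ((injective_iff_map_eq_zero _).2 fun w hw => Subtype.ext ?_)
    (innerSL ℝ y.snd ∘L WithLp.sndL 2 ℝ (L2 Ω) (L2Vec Ω)).toLinearMap
  exact eq_zero_of_mem_H10_of_fst_eq_zero hΩ w.2.1 hw

/-- The functional `z ↦ (u, z) - a(y, z)`. -/
def residual (y : Pair Ω) (u : L2 Ω) : Pair Ω →L[ℝ] ℝ :=
  innerSL ℝ u ∘L WithLp.fstL 2 ℝ (L2 Ω) (L2Vec Ω) -
    innerSL ℝ y.snd ∘L WithLp.sndL 2 ℝ (L2 Ω) (L2Vec Ω)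

lemma residual_apply (y : Pair Ω) (u : L2 Ω) (z : Pair Ω) :
    residual y u z = inner ℝ u z.fst - a y z :=
  rfl

lemma residual_add_right (y : Pair Ω) (u h : L2 Ω) (z : Pair Ω) :
    residual y (u + h) z = residual y u z + inner ℝ h z.fst := by
  rw [residual_apply, residual_apply, inner_add_left]
  ring

lemma isFeasible_iff :
    IsFeasible 𝒯 y u ↔ y ∈ Vh 𝒯 ∧
      ∀ v ∈ Vh 𝒯, residual y u (v - y) ≤ normL1 v.fst - normL1 y.fst := by
  refine and_congr_right fun _ => forall₂_congr fun v _ => ?_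
  rw [residual_apply, sub_le_iff_le_add', add_sub_assoc]

lemma convex_setOf_isFeasible (𝒯 : Mesh Ω) (y : Pair Ω) : Convex ℝ {u | IsFeasible 𝒯 y u} := by
  intro u hu u' hu' s t hs ht hst
  rw [mem_ofPred_eq, isFeasible_iff] at hu hu' ⊢
  refine ⟨hu.1, fun v hv => ?_⟩
  have residual_combo : residual y (s • u + t • u') (v - y) =
      s • residual y u (v - y) + t • residual y u' (v - y) := by
    simp only [residual_apply, inner_add_left, real_inner_smul_left, smul_eq_mul]
    linear_combination a y (v - y) * hst
  rw [residual_combo]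
  exact convex_Iic (𝕜 := ℝ) _ (mem_Iic.2 (hu.2 v hv)) (mem_Iic.2 (hu'.2 v hv)) hs ht hst

lemma IsFeasible.add_of_mem_orthogonal (hf : IsFeasible 𝒯 y u) {h : L2 Ω} (hh : h ∈ (VhFst 𝒯)ᗮ) :
    IsFeasible 𝒯 y (u + h) := by
  rw [isFeasible_iff] at hf ⊢
  refine ⟨hf.1, fun v hv => ?_⟩
  have orth : inner ℝ h (v - y).fst = 0 :=
    Submodule.inner_left_of_mem_orthogonal (fst_mem_VhFst (sub_mem hv hf.1)) hh
  rw [residual_add_right, orth, add_zero]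
  exact hf.2 v hv

lemma IsFeasible.normL1_le_residual (hf : IsFeasible 𝒯 y u) : normL1 y.fst ≤ residual y u y := by
  have normL1_zero : normL1 (0 : L2 Ω) = 0 := by
    refine (integral_congr_ae ?_).trans (integral_zero _ ℝ)
    filter_upwards [Lp.coeFn_zero ℝ 2 (volume.restrict Ω)] with x hx
    rw [hx, Pi.zero_apply, abs_zero]
  have test_zero := (isFeasible_iff.1 hf).2 0 (Vh 𝒯).zero_mem
  rw [zero_sub, map_neg, WithLp.zero_fst, normL1_zero] at test_zero
  linarith

section Subgradient

variable [IsFiniteMeasure (volume.restrict Ω)]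

lemma IsFeasible.residual_le (hf : IsFeasible 𝒯 y u) {z : Pair Ω} (hz : z ∈ Vh 𝒯) :
    residual y u z ≤ inner ℝ (absSubgradL2 y.fst z.fst) z.fst := by
  refine ge_of_tendsto (tendsto_inner_absSubgradL2_add_smul y.fst z.fst) ?_
  filter_upwards [self_mem_nhdsWithin] with t ht
  refine le_of_mul_le_mul_left ?_ ht
  have test := (isFeasible_iff.1 hf).2 (y + t • z) (add_mem hf.1 (Submodule.smul_mem _ t hz))
  have subgrad := inner_absSubgradL2_sub_le (y.fst + t • z.fst) 0 y.fst
  rw [sub_add_cancel_left, inner_neg_right, real_inner_smul_right] at subgrad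
  rw [add_sub_cancel_left, map_smul, smul_eq_mul] at test
  calc t * residual y u z ≤ normL1 (y.fst + t • z.fst) - normL1 y.fst := test
    _ ≤ t * inner ℝ (absSubgradL2 (y.fst + t • z.fst) 0) z.fst := by
        unfold normL1
        linarith

lemma isFeasible_absSubgradL2_add (hy : y ∈ Vh 𝒯) {h : L2 Ω}
    (hh : ∀ v ∈ Vh 𝒯, inner ℝ h v.fst = a y v) (z : L2 Ω) :
    IsFeasible 𝒯 y (absSubgradL2 y.fst z + h) := by
  refine isFeasible_iff.2 ⟨hy, fun v hv => ?_⟩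
  rw [residual_add_right, hh _ (sub_mem hv hy), residual_apply, sub_add_cancel]
  exact inner_absSubgradL2_sub_le _ _ _

lemma IsFeasible.add_smul [NeZero d] (hf : IsFeasible 𝒯 y u) {w : Pair Ω} (hw : w ∈ Vh 𝒯)
    (critical : inner ℝ (absSubgradL2 y.fst w.fst) w.fst ≤ residual y u w) {h : L2 Ω}
    (hh : ∀ v ∈ Vh 𝒯, inner ℝ h v.fst = a w v) {t : ℝ} (ht : 0 < t) :
    IsFeasible 𝒯 (y + t • w) (u + (t • h + (VhFst 𝒯).starProjection
      (absSubgradL2 (y.fst + t • w.fst) 0 - absSubgradL2 y.fst w.fst))) := by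
  set g := absSubgradL2 (y.fst + t • w.fst) 0 - absSubgradL2 y.fst w.fst
  have hyw : y + t • w ∈ Vh 𝒯 := add_mem hf.1 (Submodule.smul_mem _ t hw)
  refine isFeasible_iff.2 ⟨hyw, fun v hv => ?_⟩
  set z := v - (y + t • w)
  have hz : z ∈ Vh 𝒯 := sub_mem hv hyw
  have residual_eq : residual (y + t • w) (u + (t • h + (VhFst 𝒯).starProjection g)) z =
      residual y u z + inner ℝ g z.fst := by
    rw [residual_apply, residual_apply, inner_add_left, inner_add_left, real_inner_smul_left,
      hh z hz, inner_starProjection_of_mem (fst_mem_VhFst hz)]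
    simp only [a, WithLp.add_snd, WithLp.smul_snd, inner_add_left, real_inner_smul_left]
    ring
  have residual_le : residual y u z ≤ inner ℝ (absSubgradL2 y.fst v.fst) v.fst - normL1 y.fst -
      t * inner ℝ (absSubgradL2 y.fst w.fst) w.fst := by
    simp only [z, map_sub, map_add, map_smul, smul_eq_mul]
    linarith [hf.residual_le hv, hf.normL1_le_residual, mul_le_mul_of_nonneg_left critical ht.le]
  have jump_le := inner_absSubgradL2_add_inner_jump_le y.fst (t • w.fst) v.fst
  rw [absSubgradL2_smul_right _ _ ht, real_inner_smul_right] at jump_le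
  rw [residual_eq]
  exact (add_le_add_left residual_le _).trans jump_le

end Subgradient

lemma J_add (ν : ℝ) (yd ud : L2 Ω) (y η : Pair Ω) (u δ : L2 Ω) :
    J ν yd ud (y + η) (u + δ) = J ν yd ud y u + inner ℝ (y.fst - yd) η.fst +
      ν * inner ℝ (u - ud) δ + 1 / 2 * ‖η.fst‖ ^ 2 + ν / 2 * ‖δ‖ ^ 2 := by
  rw [J, J, WithLp.add_fst, add_sub_right_comm, add_sub_right_comm, norm_add_sq_real,
    norm_add_sq_real]
  ring

lemma IsLocalSolution.first_order (hloc : IsLocalSolution 𝒯 ν yd ud ybar ubar) (hν : 0 ≤ ν)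
    {η : Pair Ω} {δ : ℝ → L2 Ω} {C κ : ℝ}
    (feasible : ∀ᶠ t in 𝓝[>] 0, IsFeasible 𝒯 (ybar + t • η) (ubar + δ t))
    (norm_le : ∀ᶠ t in 𝓝[>] 0, ‖δ t‖ ≤ C * t)
    (inner_le : ∀ᶠ t in 𝓝[>] 0, inner ℝ (ubar - ud) (δ t) ≤ κ * t) :
    0 ≤ inner ℝ (ybar.fst - yd) η.fst + ν * κ := by
  obtain ⟨-, ε, hε, hmin⟩ := hloc
  have state_near : ∀ᶠ t : ℝ in 𝓝[>] 0, ‖t • η‖ ≤ ε := by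
    have cont : Continuous fun t : ℝ => ‖t • η‖ := by fun_prop
    exact nhdsWithin_le_nhds ((cont.tendsto 0).eventually_le_const (by simpa using hε))
  have control_near : ∀ᶠ t : ℝ in 𝓝[>] 0, C * t ≤ ε := by
    have cont : Continuous fun t : ℝ => C * t := by fun_prop
    exact nhdsWithin_le_nhds ((cont.tendsto 0).eventually_le_const (by simpa using hε))
  set X := inner ℝ (ybar.fst - yd) η.fst + ν * κ with hX
  set D := 1 / 2 * ‖η.fst‖ ^ 2 + ν / 2 * C ^ 2 with hD
  have quotient_nonneg : ∀ᶠ t in 𝓝[>] 0, 0 ≤ X + t * D := by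
    filter_upwards [feasible, norm_le, inner_le, state_near, control_near, self_mem_nhdsWithin]
      with t hf hδ hκ hη hC ht
    have J_le := hmin _ _ hf (by rwa [add_sub_cancel_left])
      (by rw [add_sub_cancel_left]; exact hδ.trans hC)
    rw [J_add, WithLp.smul_fst, real_inner_smul_right, norm_smul, Real.norm_of_nonneg ht.le]
      at J_le
    refine nonneg_of_mul_nonneg_right ?_ ht
    calc 0 ≤ t * inner ℝ (ybar.fst - yd) η.fst + ν * inner ℝ (ubar - ud) (δ t) +
          1 / 2 * (t * ‖η.fst‖) ^ 2 + ν / 2 * ‖δ t‖ ^ 2 := by linarith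
      _ ≤ t * inner ℝ (ybar.fst - yd) η.fst + ν * (κ * t) +
          1 / 2 * (t * ‖η.fst‖) ^ 2 + ν / 2 * (C * t) ^ 2 := by gcongr
      _ = t * (X + t * D) := by rw [hX, hD]; ring
  have lim : Tendsto (fun t => X + t * D) (𝓝[>] 0) (𝓝 X) := by
    have cont : Continuous fun t : ℝ => X + t * D := by fun_prop
    simpa using (cont.tendsto 0).mono_left nhdsWithin_le_nhds
  exact ge_of_tendsto lim quotient_nonneg

lemma IsLocalSolution.inner_sub_nonneg (hloc : IsLocalSolution 𝒯 ν yd ud ybar ubar) (hν : 0 < ν)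
    (hu : IsFeasible 𝒯 ybar u) : 0 ≤ inner ℝ (ubar - ud) (u - ubar) := by
  have first_order := hloc.first_order hν.le (η := 0) (δ := fun t => t • (u - ubar))
    (C := ‖u - ubar‖) (κ := inner ℝ (ubar - ud) (u - ubar)) ?_ ?_ ?_
  · rw [WithLp.zero_fst, inner_zero_right, zero_add] at first_order
    exact nonneg_of_mul_nonneg_right first_order hν
  · filter_upwards [Ioo_mem_nhdsGT one_pos] with t ht
    rw [smul_zero, add_zero]
    exact (convex_setOf_isFeasible 𝒯 ybar).add_smul_sub_mem hloc.1 hu (Ioo_subset_Icc_self ht)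
  · filter_upwards [self_mem_nhdsWithin] with t ht
    rw [norm_smul, Real.norm_of_nonneg (le_of_lt ht), mul_comm]
  · filter_upwards with t
    rw [real_inner_smul_right, mul_comm]

variable [NeZero d]

lemma IsLocalSolution.sub_mem_VhFst (hloc : IsLocalSolution 𝒯 ν yd ud ybar ubar) (hν : 0 < ν) :
    ubar - ud ∈ VhFst 𝒯 := by
  have inner_nonneg : ∀ h ∈ (VhFst 𝒯)ᗮ, 0 ≤ inner ℝ (ubar - ud) h := fun h hh => by
    simpa only [add_sub_cancel_left] using
      hloc.inner_sub_nonneg hν (hloc.1.add_of_mem_orthogonal hh)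
  rw [← Submodule.orthogonal_orthogonal (VhFst 𝒯), Submodule.mem_orthogonal']
  intro h hh
  have neg_nonneg := inner_nonneg (-h) (neg_mem hh)
  rw [inner_neg_right, Left.nonneg_neg_iff] at neg_nonneg
  exact le_antisymm neg_nonneg (inner_nonneg h hh)

lemma IsLocalSolution.inner_absSubgradL2_le_residual [IsFiniteMeasure (volume.restrict Ω)]
    (hloc : IsLocalSolution 𝒯 ν yd ud ybar ubar) (hΩ : IsOpen Ω) (hν : 0 < ν) {w : Pair Ω}
    (hw : w ∈ Vh 𝒯) (hwu : w.fst = ud - ubar) :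
    inner ℝ (absSubgradL2 ybar.fst w.fst) w.fst ≤ residual ybar ubar w := by
  obtain ⟨h, hh⟩ := exists_inner_fst_eq_a hΩ 𝒯 ybar
  have optimality := hloc.inner_sub_nonneg hν (isFeasible_absSubgradL2_add hloc.1.1 hh w.fst)
  rw [← neg_sub ud ubar, ← hwu, inner_neg_left, real_inner_comm, inner_sub_left, inner_add_left,
    hh w hw] at optimality
  rw [residual_apply]
  linarith

lemma IsLocalSolution.mul_a_le (hloc : IsLocalSolution 𝒯 ν yd ud ybar ubar) (hΩ : IsOpen Ω)
    (hν : 0 < ν) {w : Pair Ω} (hw : w ∈ Vh 𝒯) (hwu : w.fst = ud - ubar) :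
    ν * a w w ≤ inner ℝ (ybar.fst - yd) w.fst := by
  have := 𝒯.isFiniteMeasure_restrict
  obtain ⟨h, hh⟩ := exists_inner_fst_eq_a hΩ 𝒯 w
  obtain ⟨C, hC⟩ := exists_integral_abs_jump_le (hasThinSublevels_of_mem_Vh hloc.1.1)
    (memLp_top_of_mem_Vh hw)
  obtain ⟨B, hB, norm_proj_le⟩ := exists_norm_starProjection_le_mul_integral_abs (VhFst 𝒯) (by
    rintro _ ⟨v, hv, rfl⟩
    exact memLp_top_of_mem_Vh hv)
  set g : ℝ → L2 Ω := fun t =>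
    absSubgradL2 (ybar.fst + t • w.fst) 0 - absSubgradL2 ybar.fst w.fst
  have first_order := hloc.first_order hν.le (η := w) (C := ‖h‖ + B * C) (κ := -a w w)
    (δ := fun t => t • h + (VhFst 𝒯).starProjection (g t)) ?_ ?_ ?_
  · linarith
  · filter_upwards [self_mem_nhdsWithin] with t ht
    exact hloc.1.add_smul hw (hloc.inner_absSubgradL2_le_residual hΩ hν hw hwu) hh ht
  · filter_upwards [self_mem_nhdsWithin] with t ht
    calc ‖t • h + (VhFst 𝒯).starProjection (g t)‖
        ≤ t * ‖h‖ + B * (C * t) := by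
          refine (norm_add_le _ _).trans (add_le_add ?_ ((norm_proj_le _).trans ?_))
          · rw [norm_smul, Real.norm_of_nonneg (le_of_lt ht)]
          · gcongr
            exact hC t ht
      _ = (‖h‖ + B * C) * t := by ring
  · filter_upwards [self_mem_nhdsWithin] with t ht
    have jump_nonneg : 0 ≤ inner ℝ (g t) w.fst := by
      have := inner_absSubgradL2_jump_nonneg ybar.fst (t • w.fst)
      rw [absSubgradL2_smul_right _ _ ht, real_inner_smul_right] at this
      exact nonneg_of_mul_nonneg_right this ht
    rw [← neg_sub ud ubar, ← hwu, inner_neg_left, real_inner_comm, inner_add_left,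
      real_inner_smul_left, hh w hw, inner_starProjection_of_mem (fst_mem_VhFst hw)]
    linarith

end Optimality

end DiscreteVI

end

theorem proposition3p2 {d : ℕ} (hd : 1 ≤ d) (Ω : Set (DiscreteVI.Rd d)) (hΩ : IsOpen Ω)
    (hbdd : Bornology.IsBounded Ω) (𝒯 : DiscreteVI.Mesh Ω) (ν : ℝ) (hν : 0 < ν)
    (yd ud : DiscreteVI.L2 Ω) :
    (∃ c : ℝ, DiscreteVI.IsCoercivityConstant Ω c) ∧
    ∀ (ybar : DiscreteVI.Pair Ω) (ubar : DiscreteVI.L2 Ω),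
      DiscreteVI.IsLocalSolution 𝒯 ν yd ud ybar ubar →
      ∃ w ∈ DiscreteVI.Vh 𝒯, w.fst = ubar - ud ∧
        ∀ c : ℝ, DiscreteVI.IsCoercivityConstant Ω c →
          ‖w‖ ≤ 1 / (ν * c) * (‖ybar.fst‖ + ‖yd‖) := by
  have : NeZero d := ⟨by omega⟩
  refine ⟨DiscreteVI.exists_isCoercivityConstant hbdd, fun ybar ubar hloc => ?_⟩
  obtain ⟨w, hw, hwu : w.fst = ubar - ud⟩ := hloc.sub_mem_VhFst hν
  refine ⟨w, hw, hwu, fun c hc => ?_⟩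
  have hneg : (-w).fst = ud - ubar := by rw [WithLp.neg_fst, hwu, neg_sub]
  calc ‖w‖ = ‖-w‖ := (norm_neg w).symm
    _ ≤ 1 / (ν * c) * ‖ybar.fst - yd‖ :=
        hc.norm_le hν (neg_mem hw.1) (hloc.mul_a_le hΩ hν (neg_mem hw) hneg)
    _ ≤ 1 / (ν * c) * (‖ybar.fst‖ + ‖yd‖) := by
        have := hc.1
        gcongr
        exact norm_sub_le _ _
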